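/- Let $A\in SL_2(\mathbb Z)$ be a fixed hyperbolic matrix ($|\operatorname{tr}A|>2$), let $\alpha$ be an eigenvalue of $A$ and $\mathfrak O=\mathbb Z[\alpha]$, with norm map $\mathcal N$, and let $\iota:\mathfrak O\to \mathrm{Mat}_2(\mathbb Z)$ be the ring homomorphism $x+y\alpha\mapsto x+yA$. For $N\ge 1$ let $\mathcal H_N=L^2(\mathbb Z/N\mathbb Z)$ with $\langle\phi,\psi\rangle=\frac1N\sum_{Q \bmod N}\phi(Q)\overline{\psi(Q)}$ and $\|\psi\|_2^2=\langle\psi,\psi\rangle$, and for $n=(n_1,n_2)\in\mathbb Z^2$ let $$(T_N(n)\psi)(Q)=e^{i\pi n_1n_2/N}\,e^{2\pi i n_2Q/N}\,\psi(Q+n_1).$$ For $B\in SL_2(\mathbb Z/2N\mathbb Z)$ congruent to the identity modulo $4$ if $N$ is even, and modulo $2$ if $N$ is odd, let $U_N(B)$ be its quantization: the unitary operator on $\mathcal H_N$, unique up to a phase, such that $U_N(B)^{-1}T_N(n)U_N(B)=T_N(nB)$ for all $n\in\mathbb Z^2$. Let $\mathcal T^\theta(2N)$ be the group of the elements of $\mathfrak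 O/2N\mathfrak O$ of norm $1$ in $\mathbb Z/2N\mathbb Z$ that are congruent to $1$ modulo $4\mathfrak O$ if $N$ is even, and modulo $2\mathfrak O$ if $N$ is odd. A Hecke eigenfunction is a nonzero $\psi\in\mathcal H_N$ that is an eigenfunction of all the Hecke operators $U_N(\iota(\beta))$, $\beta\in\mathcal T^\theta(2N)$. Then for every $\epsilon>0$ there is a constant $C=C(A,\epsilon)>0$ such that for every $N\ge1$ and every Hecke eigenfunction $\psi\in\mathcal H_N$ with $\|\psi\|_2=1$, $$\|\psi\|_\infty=\max_{Q\in\mathbb Z/N\mathbb Z}|\psi(Q)|\le C\,N^{3/8+\epsilon}.$$ -/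

import Mathlib

open Matrix

namespace CatMap

/-! ## The Hilbert space of states `L²(ℤ/Nℤ)` -/

/-- The inner product `⟨φ, ψ⟩ = (1/N) ∑_{Q mod N} φ(Q) conj(ψ(Q))` on functions on `ℤ/Nℤ`. -/
noncomputable def innerL2 (N : ℕ) [NeZero N] (φ ψ : ZMod N → ℂ) : ℂ :=
  (1 / (N : ℂ)) * ∑ Q, φ Q * (starRingEnd ℂ) (ψ Q)

/-- The normalized norm: `‖ψ‖₂² = (1/N) ∑_{Q mod N} |ψ(Q)|²`. -/
noncomputable def normL2 (N : ℕ) [NeZero N] (ψ : ZMod N → ℂ) : ℝ :=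
  Real.sqrt ((1 / (N : ℝ)) * ∑ Q, ‖ψ Q‖ ^ 2)

/-- The elementary observables: for `n = (n₁, n₂) ∈ ℤ²`,
`(T_N(n) ψ)(Q) = exp(iπ n₁ n₂ / N) e(n₂ Q / N) ψ(Q + n₁)`.
Here `ZMod.stdAddChar (j mod N) = e(j / N) = exp(2πi j / N)`. -/
noncomputable def T (N : ℕ) [NeZero N] (n : Fin 2 → ℤ) :
    (ZMod N → ℂ) →ₗ[ℂ] (ZMod N → ℂ) where
  toFun ψ Q := Complex.exp (Complex.I * Real.pi * (n 0) * (n 1) / N) *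
    ZMod.stdAddChar ((n 1 : ZMod N) * Q) * ψ (Q + (n 0 : ZMod N))
  map_add' φ ψ := by
    funext Q
    simp [mul_add]
  map_smul' c ψ := by
    funext Q
    simp only [Pi.smul_apply, smul_eq_mul, RingHom.id_apply]
    ring

/-! ## Quantization of matrices -/

/-- The level of the congruence condition: `4` if `N` is even and `2` if `N` is odd. -/
def level (N : ℕ) : ℕ := if Even N then 4 else 2

/-- The image in `SL₂(ℤ/2Nℤ)` of the group of matrices of `SL₂(ℤ)` that are congruent to the
identity modulo `4` (if `N` is even) or modulo `2` (if `N` is odd). -/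
def thetaGroup (N : ℕ) : Set (SpecialLinearGroup (Fin 2) (ZMod (2 * N))) :=
  {B | ∃ C : Matrix (Fin 2) (Fin 2) (ZMod (2 * N)),
    (B : Matrix (Fin 2) (Fin 2) (ZMod (2 * N))) = 1 + (level N : ZMod (2 * N)) • C}

/-- `U` is a quantization of `B`: it is unitary on `L²(ℤ/Nℤ)` and satisfies the exact Egorov
property `U⁻¹ T_N(n) U = T_N(nB)` for all `n ∈ ℤ²`. (The observable `e(n·x)` is quantized by
`T_N(n)` and becomes `e(nB·x)` under the classical evolution; a general smooth observable is a
superposition of these. The operator `T_N(n)` depends only on `n` modulo `2N`, so `B` need only be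
given modulo `2N`.) -/
structure IsQuantization (N : ℕ) [NeZero N] (B : SpecialLinearGroup (Fin 2) (ZMod (2 * N)))
    (U : (ZMod N → ℂ) →ₗ[ℂ] (ZMod N → ℂ)) : Prop where
  unitary : ∀ φ ψ, innerL2 N (U φ) (U ψ) = innerL2 N φ ψ
  egorov : ∀ n m : Fin 2 → ℤ,
    (fun i => (m i : ZMod (2 * N))) =
      (fun i => (n i : ZMod (2 * N))) ᵥ* (B : Matrix (Fin 2) (Fin 2) (ZMod (2 * N))) →
    T N n ∘ₗ U = U ∘ₗ T N m

/-! ### Existence of quantizations, and uniqueness up to a phase -/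

section Existence

variable (N : ℕ)

def red : ZMod (2 * N) →+* ZMod N := ZMod.castHom (Dvd.intro_left 2 rfl) (ZMod N)

lemma red_int (j : ℤ) : red N (j : ZMod (2 * N)) = (j : ZMod N) := by
  simp

lemma red_surj (x : ZMod N) : ∃ y, red N y = x := ZMod.castHom_surjective _ x

lemma sum_vecMul_symp (B : SpecialLinearGroup (Fin 2) (ZMod (2 * N)))
    (m n : Fin 2 → ZMod (2 * N)) :
    (m ᵥ* B.1) 0 * (n ᵥ* B.1) 1 - (n ᵥ* B.1) 0 * (m ᵥ* B.1) 1 =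
      m 0 * n 1 - n 0 * m 1 := by
  have h := B.2
  rw [Matrix.det_fin_two] at h
  simp only [Matrix.vecMul, dotProduct, Fin.sum_univ_two]
  linear_combination (m 0 * n 1 - n 0 * m 1) * h

lemma vecMul_surj (B : SpecialLinearGroup (Fin 2) (ZMod (2 * N)))
    (n : Fin 2 → ZMod (2 * N)) : ∃ m, m ᵥ* B.1 = n := by
  refine ⟨n ᵥ* B.1.adjugate, ?_⟩
  rw [Matrix.vecMul_vecMul, Matrix.adjugate_mul, B.2, one_smul, Matrix.vecMul_one]

lemma two_mul_of_red (x : ZMod (2 * N)) (h : red N x = 0) : 2 * x = 0 := by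
  obtain ⟨j, rfl⟩ := ZMod.intCast_surjective x
  rw [red_int, ZMod.intCast_zmod_eq_zero_iff_dvd] at h
  obtain ⟨k, rfl⟩ := h
  have : (2 * ((N * k : ℤ) : ZMod (2 * N))) = ((2 * N : ℕ) : ZMod (2 * N)) * k := by
    push_cast; ring
  rw [this]
  simp only [ZMod.natCast_self, zero_mul]

variable [NeZero N]

lemma char_red (x : ZMod (2 * N)) :
    (ZMod.stdAddChar (red N x) : ℂ) = ZMod.stdAddChar (2 * x) := by
  obtain ⟨j, rfl⟩ := ZMod.intCast_surjective x
  have hN : (N : ℂ) ≠ 0 := by exact_mod_cast NeZero.ne N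
  have h2 : (2 * (j : ZMod (2 * N))) = ((2 * j : ℤ) : ZMod (2 * N)) := by push_cast; ring
  rw [red_int, h2, ZMod.stdAddChar_coe, ZMod.stdAddChar_coe]
  congr 1
  push_cast
  field_simp

/-- `T_N` as a function of `n` modulo `2N`. -/
noncomputable def TZ (n : Fin 2 → ZMod (2 * N)) :
    (ZMod N → ℂ) →ₗ[ℂ] (ZMod N → ℂ) where
  toFun ψ Q := ZMod.stdAddChar (n 0 * n 1) *
    ZMod.stdAddChar (red N (n 1) * Q) * ψ (Q + red N (n 0))
  map_add' φ ψ := by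
    funext Q
    simp [mul_add]
  map_smul' c ψ := by
    funext Q
    simp only [Pi.smul_apply, smul_eq_mul, RingHom.id_apply]
    ring

lemma TZ_apply (n : Fin 2 → ZMod (2 * N)) (ψ : ZMod N → ℂ) (Q : ZMod N) :
    TZ N n ψ Q = ZMod.stdAddChar (n 0 * n 1) *
      ZMod.stdAddChar (red N (n 1) * Q) * ψ (Q + red N (n 0)) := rfl

lemma T_eq_TZ (n : Fin 2 → ℤ) : T N n = TZ N (fun i => (n i : ZMod (2 * N))) := by
  ext1 k
  ext Q
  have hN : (N : ℂ) ≠ 0 := by exact_mod_cast NeZero.ne N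
  have h : ((n 0 : ZMod (2 * N)) * (n 1 : ZMod (2 * N))) = ((n 0 * n 1 : ℤ) : ZMod (2 * N)) := by
    push_cast; ring
  simp only [LinearMap.comp_apply, TZ_apply, red_int, h, ZMod.stdAddChar_coe]
  simp only [T, LinearMap.coe_mk, AddHom.coe_mk]
  congr 3
  push_cast
  field_simp

lemma TZ_mul (m n : Fin 2 → ZMod (2 * N)) (ψ : ZMod N → ℂ) :
    TZ N m (TZ N n ψ) =
      (ZMod.stdAddChar (m 0 * n 1 - n 0 * m 1) : ℂ) • TZ N (m + n) ψ := by
  funext Q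
  obtain ⟨q, rfl⟩ : ∃ q, red N q = Q := ZMod.castHom_surjective _ Q
  simp only [TZ_apply, Pi.smul_apply, smul_eq_mul, Pi.add_apply, map_add]
  rw [add_assoc]
  simp only [← map_add, ← map_mul, char_red, ← mul_assoc, ← AddChar.map_add_eq_mul]
  congr 2
  ring

lemma TZ_of_red (n : Fin 2 → ZMod (2 * N)) (h : ∀ i, red N (n i) = 0)
    (ψ : ZMod N → ℂ) : TZ N n ψ = (ZMod.stdAddChar (n 0 * n 1) : ℂ) • ψ := by
  funext Q
  simp [TZ_apply, h]

lemma TZ_single (n : Fin 2 → ZMod (2 * N)) (k : ZMod N) :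
    TZ N n (Pi.single k 1) = ((ZMod.stdAddChar (n 0 * n 1) : ℂ) *
      ZMod.stdAddChar (red N (n 1) * (k - red N (n 0)))) • Pi.single (k - red N (n 0)) 1 := by
  funext Q
  rw [TZ_apply, Pi.smul_apply, smul_eq_mul]
  by_cases hQ : Q = k - red N (n 0)
  · subst hQ
    simp
  · have : Q + red N (n 0) ≠ k := fun h => hQ (by rw [← h]; ring)
    simp [hQ, this]

lemma trace_TZ (n : Fin 2 → ZMod (2 * N)) :
    ∑ a, TZ N n (Pi.single a 1) a =
      if ∀ i, red N (n i) = 0 then (N : ℂ) * ZMod.stdAddChar (n 0 * n 1) else 0 := by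
  split_ifs with h
  · simp [TZ_of_red N n h]
  · by_cases h0 : red N (n 0) = 0
    · have h1 : red N (n 1) ≠ 0 := fun h1 => h (by intro i; fin_cases i <;> simpa)
      simp only [TZ_apply, h0, add_zero, Pi.single_eq_same, mul_one]
      rw [← Finset.mul_sum]
      have := AddChar.sum_mulShift (R := ZMod N) (red N (n 1)) (ZMod.isPrimitive_stdAddChar N)
      simp only [mul_comm _ (red N (n 1)), h1, if_false] at this
      rw [this]
      simp
    · apply Finset.sum_eq_zero
      intro a _
      rw [TZ_apply, Pi.single_apply, if_neg (by simpa using h0), mul_zero]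

/-- The averaged operator `∑_n T(n) E_{ab} T(-nB)`. -/
noncomputable def avg (B : SpecialLinearGroup (Fin 2) (ZMod (2 * N))) (a b : ZMod N) :
    (ZMod N → ℂ) →ₗ[ℂ] (ZMod N → ℂ) :=
  ∑ n : Fin 2 → ZMod (2 * N), TZ N n ∘ₗ
    (LinearMap.proj b : (ZMod N → ℂ) →ₗ[ℂ] ℂ).smulRight (Pi.single a 1) ∘ₗ TZ N (-(n ᵥ* B.1))

lemma avg_apply (B : SpecialLinearGroup (Fin 2) (ZMod (2 * N))) (a b : ZMod N)
    (φ : ZMod N → ℂ) :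
    avg N B a b φ = ∑ n : Fin 2 → ZMod (2 * N),
      TZ N (-(n ᵥ* B.1)) φ b • TZ N n (Pi.single a 1) := by
  simp [avg, LinearMap.sum_apply]

lemma avg_intertwines (B : SpecialLinearGroup (Fin 2) (ZMod (2 * N))) (a b : ZMod N)
    (m : Fin 2 → ZMod (2 * N)) (φ : ZMod N → ℂ) :
    TZ N m (avg N B a b φ) = avg N B a b (TZ N (m ᵥ* B.1) φ) := by
  rw [avg_apply, avg_apply, map_sum]
  rw [← Equiv.sum_comp (Equiv.addLeft m)
    (fun n => TZ N (-(n ᵥ* B.1)) (TZ N (m ᵥ* B.1) φ) b • TZ N n (Pi.single a 1))]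
  refine Finset.sum_congr rfl fun n _ => ?_
  simp only [Equiv.coe_addLeft, map_smul, TZ_mul, Pi.smul_apply, smul_smul, smul_eq_mul]
  have e1 : -((m + n) ᵥ* B.1) + m ᵥ* B.1 = -(n ᵥ* B.1) := by
    rw [Matrix.add_vecMul]; abel
  rw [e1, mul_comm]
  congr 3
  have := sum_vecMul_symp N B m n
  simp only [Matrix.add_vecMul, Pi.neg_apply, Pi.add_apply] at this ⊢
  linear_combination -this

lemma exists_avg_ne_zero (B : SpecialLinearGroup (Fin 2) (ZMod (2 * N)))
    (hB : B ∈ thetaGroup N) : ∃ a b, avg N B a b ≠ 0 := by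
  by_contra! hz
  have h2 : ∃ C : Matrix (Fin 2) (Fin 2) (ZMod (2 * N)), B.1 = 1 + (2 : ZMod (2 * N)) • C := by
    obtain ⟨C, hC⟩ := hB
    unfold level at hC
    split_ifs at hC
    · refine ⟨(2 : ZMod (2 * N)) • C, ?_⟩
      rw [hC, smul_smul]; norm_num
    · exact ⟨C, by simpa using hC⟩
  obtain ⟨C, hC⟩ := h2
  have key : ∑ a, avg N B a 0 (Pi.single 0 1) a = 0 := by simp [hz]
  have h3 : ∑ a, avg N B a 0 (Pi.single 0 1) a =
      ∑ n : Fin 2 → ZMod (2 * N), (if ∀ i, red N (n i) = 0 then (N : ℂ) else 0) := by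
    simp only [avg_apply, Finset.sum_apply, Pi.smul_apply, smul_eq_mul]
    rw [Finset.sum_comm]
    refine Finset.sum_congr rfl fun n _ => ?_
    rw [← Finset.mul_sum, trace_TZ]
    split_ifs with h
    · have hn : ∀ i, 2 * n i = 0 := fun i => two_mul_of_red N _ (h i)
      have hB' : n ᵥ* B.1 = n := by
        rw [hC, Matrix.vecMul_add, Matrix.vecMul_one, Matrix.vecMul_smul,
          ← Matrix.smul_vecMul]
        have : (2 : ZMod (2 * N)) • n = 0 := by funext i; simpa using hn i
        simp [this]
      have hneg : -n = n := by
        funext i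
        have := hn i
        simp only [Pi.neg_apply]
        linear_combination -this
      rw [hB', hneg, TZ_of_red N n h]
      simp only [Pi.smul_apply, Pi.single_eq_same, smul_eq_mul, mul_one]
      have h1 : (ZMod.stdAddChar (n 0 * n 1) : ℂ) * ZMod.stdAddChar (n 0 * n 1) = 1 := by
        rw [← AddChar.map_add_eq_mul]
        have : n 0 * n 1 + n 0 * n 1 = 0 := by linear_combination n 1 * hn 0
        rw [this, AddChar.map_zero_eq_one]
      linear_combination (N : ℂ) * h1
    · simp
  rw [h3, Finset.sum_ite, Finset.sum_const_zero, add_zero, Finset.sum_const, nsmul_eq_mul] at key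
  rcases mul_eq_zero.mp key with h | h
  · rw [Nat.cast_eq_zero, Finset.card_eq_zero] at h
    have : (0 : Fin 2 → ZMod (2 * N)) ∈
        Finset.univ.filter (fun n : Fin 2 → ZMod (2 * N) => ∀ i, red N (n i) = 0) := by simp
    rw [h] at this
    simp at this
  · exact NeZero.ne N (by exact_mod_cast h)

lemma innerL2_TZ (n : Fin 2 → ZMod (2 * N)) (φ ψ : ZMod N → ℂ) :
    innerL2 N (TZ N n φ) (TZ N n ψ) = innerL2 N φ ψ := by
  unfold innerL2
  congr 1
  rw [← Equiv.sum_comp (Equiv.addRight (red N (n 0)))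
    (fun Q => φ Q * (starRingEnd ℂ) (ψ Q))]
  refine Finset.sum_congr rfl fun Q _ => ?_
  have h : ∀ (M : ℕ) [NeZero M] (x : ZMod M),
      (ZMod.stdAddChar x : ℂ) * (starRingEnd ℂ) (ZMod.stdAddChar x) = 1 := by
    intro M _ x
    rw [Complex.mul_conj, ZMod.stdAddChar_apply, Circle.normSq_coe, Complex.ofReal_one]
  simp only [TZ_apply, Equiv.coe_addRight, map_mul]
  linear_combination (φ (Q + red N (n 0)) * (starRingEnd ℂ) (ψ (Q + red N (n 0)))) *
    ((ZMod.stdAddChar (red N (n 1) * Q) : ℂ) *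
      (starRingEnd ℂ) (ZMod.stdAddChar (red N (n 1) * Q)) * h _ (n 0 * n 1) + h _ (red N (n 1) * Q))

lemma expand (φ : ZMod N → ℂ) : φ = ∑ k, φ k • Pi.single k (1 : ℂ) := by
  funext Q
  simp [Finset.sum_apply, Pi.single_apply]

lemma char_eq_one (x : ZMod N) (h : (ZMod.stdAddChar x : ℂ) = 1) : x = 0 :=
  ZMod.injective_stdAddChar (by simpa using h)

/-- Schur's lemma for sesquilinear forms `⟨V φ, V ψ⟩` invariant under all `T(n)`. -/
lemma inner_invariant (V : (ZMod N → ℂ) →ₗ[ℂ] (ZMod N → ℂ))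
    (h : ∀ n φ ψ, innerL2 N (V (TZ N n φ)) (V (TZ N n ψ)) = innerL2 N (V φ) (V ψ))
    (φ ψ : ZMod N → ℂ) :
    innerL2 N (V φ) (V ψ) =
      innerL2 N (V (Pi.single 0 1)) (V (Pi.single 0 1)) * (N * innerL2 N φ ψ) := by
  have hN : (N : ℂ) ≠ 0 := by exact_mod_cast NeZero.ne N
  have hsm : ∀ (c d : ℂ) (f g : ZMod N → ℂ),
      innerL2 N (c • f) (d • g) = c * (starRingEnd ℂ) d * innerL2 N f g := by
    intro c d f g
    simp only [innerL2, Pi.smul_apply, smul_eq_mul, map_mul, Finset.mul_sum]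
    exact Finset.sum_congr rfl fun Q _ => by ring
  have hsum : ∀ (f g : ZMod N → (ZMod N → ℂ)),
      innerL2 N (∑ j, f j) (∑ k, g k) = ∑ j, ∑ k, innerL2 N (f j) (g k) := by
    intro f g
    simp only [innerL2, Finset.sum_apply, map_sum, Finset.sum_mul_sum]
    simp only [Finset.mul_sum]
    rw [Finset.sum_comm]
    refine Finset.sum_congr rfl fun j _ => ?_
    rw [Finset.sum_comm]
  have hcc : ∀ (x : ZMod N), (starRingEnd ℂ) (ZMod.stdAddChar x : ℂ) = ZMod.stdAddChar (-x) := by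
    intro x
    rw [AddChar.map_neg_eq_inv, ZMod.stdAddChar_apply, ← Circle.coe_inv_eq_conj, Circle.coe_inv]
  have hoff : ∀ j k : ZMod N, j ≠ k →
      innerL2 N (V (Pi.single j 1)) (V (Pi.single k 1)) = 0 := by
    intro j k hjk
    have := h ![0, 1] (Pi.single j 1) (Pi.single k 1)
    simp only [TZ_single, map_smul, hsm] at this
    simp only [Matrix.cons_val_zero, Matrix.cons_val_one, zero_mul, AddChar.map_zero_eq_one,
      map_zero, sub_zero, one_mul, map_one, hcc, ← AddChar.map_add_eq_mul] at this
    by_contra hne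
    have h1 := mul_right_cancel₀ hne (this.trans (one_mul _).symm)
    have := char_eq_one N _ h1
    exact hjk (by linear_combination this)
  have hdiag : ∀ j : ZMod N, innerL2 N (V (Pi.single j 1)) (V (Pi.single j 1)) =
      innerL2 N (V (Pi.single 0 1)) (V (Pi.single 0 1)) := by
    intro j
    obtain ⟨y, hy⟩ := red_surj N j
    have := h ![y, 0] (Pi.single j 1) (Pi.single j 1)
    simp only [TZ_single, map_smul, hsm] at this
    simpa [hy] using this.symm
  conv_lhs => rw [expand N φ, expand N ψ]
  simp only [map_sum, map_smul, hsum, hsm]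
  have : (N : ℂ) * innerL2 N φ ψ = ∑ Q, φ Q * (starRingEnd ℂ) (ψ Q) := by
    unfold innerL2
    field_simp
  rw [this, Finset.mul_sum]
  refine Finset.sum_congr rfl fun j _ => ?_
  rw [Finset.sum_eq_single j]
  · rw [hdiag]; ring
  · intro k _ hk
    rw [hoff j k hk.symm, mul_zero]
  · simp

lemma innerL2_self (φ : ZMod N → ℂ) : innerL2 N φ φ = ((normL2 N φ ^ 2 : ℝ) : ℂ) := by
  unfold innerL2 normL2
  rw [Real.sq_sqrt (by positivity)]
  push_cast
  congr 1
  exact Finset.sum_congr rfl fun Q _ => Complex.mul_conj' _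

lemma normL2_eq_zero (φ : ZMod N → ℂ) (h : normL2 N φ = 0) : φ = 0 := by
  unfold normL2 at h
  have hN : (0 : ℝ) < N := by exact_mod_cast Nat.pos_of_ne_zero (NeZero.ne N)
  rw [Real.sqrt_eq_zero (by positivity), mul_eq_zero,
    Finset.sum_eq_zero_iff_of_nonneg (fun _ _ => by positivity)] at h
  rcases h with h | h
  · simp [hN.ne'] at h
  · funext Q
    simpa using h Q (Finset.mem_univ Q)

lemma commutant (W : (ZMod N → ℂ) →ₗ[ℂ] (ZMod N → ℂ))
    (h : ∀ n φ, W (TZ N n φ) = TZ N n (W φ)) : ∃ c : ℂ, ∀ φ, W φ = c • φ := by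
  refine ⟨W (Pi.single 0 1) 0, fun φ => ?_⟩
  have h0 : W (Pi.single 0 1) = W (Pi.single 0 1) 0 • Pi.single 0 1 := by
    funext Q
    by_cases hQ : Q = 0
    · subst hQ; simp
    · have := congrFun (h ![0, 1] (Pi.single 0 1)) Q
      rw [TZ_single, TZ_apply] at this
      simp only [Matrix.cons_val_zero, Matrix.cons_val_one, zero_mul, AddChar.map_zero_eq_one,
        map_zero, sub_zero, one_mul, map_one, mul_zero, one_smul, add_zero] at this
      have h1 : W (Pi.single 0 1) Q = 0 := by
        by_contra hne
        exact hQ (char_eq_one N _ (mul_right_cancel₀ hne (this.symm.trans (one_mul _).symm)))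
      rw [h1]
      simp [hQ]
  have hk : ∀ k : ZMod N, W (Pi.single k 1) = W (Pi.single 0 1) 0 • Pi.single k 1 := by
    intro k
    obtain ⟨y, hy⟩ := red_surj N (-k)
    have := h ![y, 0] (Pi.single 0 1)
    rw [h0, map_smul, TZ_single] at this
    simpa [hy] using this
  generalize W (Pi.single 0 1) 0 = c at hk
  conv_lhs => rw [expand N φ]
  conv_rhs => rw [expand N φ]
  rw [map_sum, Finset.smul_sum]
  exact Finset.sum_congr rfl fun k _ => by rw [map_smul, hk, smul_comm]

variable {N}

lemma IsQuantization.intertwines {B : SpecialLinearGroup (Fin 2) (ZMod (2 * N))}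
    {U : (ZMod N → ℂ) →ₗ[ℂ] (ZMod N → ℂ)} (hU : IsQuantization N B U)
    (n : Fin 2 → ZMod (2 * N)) (φ : ZMod N → ℂ) :
    TZ N n (U φ) = U (TZ N (n ᵥ* B.1) φ) := by
  choose f hf using ZMod.intCast_surjective (n := 2 * N)
  have := hU.egorov (fun i => f (n i)) (fun i => f ((n ᵥ* B.1) i)) (by simp [hf])
  simp only [T_eq_TZ, hf] at this
  exact LinearMap.congr_fun this φ

/-- Every matrix of the congruence group has a quantization. -/
theorem exists_isQuantization {B : SpecialLinearGroup (Fin 2) (ZMod (2 * N))}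
    (hB : B ∈ thetaGroup N) : ∃ U, IsQuantization N B U := by
  obtain ⟨a, b, hV⟩ := exists_avg_ne_zero N B hB
  set V := avg N B a b with hVdef
  have hN : (0 : ℝ) < N := by exact_mod_cast Nat.pos_of_ne_zero (NeZero.ne N)
  have hinv := inner_invariant N V (by
    intro n φ ψ
    obtain ⟨m, rfl⟩ := vecMul_surj N B n
    rw [hVdef, ← avg_intertwines, ← avg_intertwines, innerL2_TZ])
  rw [innerL2_self] at hinv
  set r : ℝ := normL2 N (V (Pi.single 0 1)) with hr
  have hr0 : r ≠ 0 := by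
    intro h0
    apply hV
    ext1 k
    ext1
    apply normL2_eq_zero
    have := hinv (Pi.single k 1) (Pi.single k 1)
    rw [h0, innerL2_self] at this
    simpa using this
  have hs : ((Real.sqrt N : ℝ) : ℂ) ^ 2 = N := by
    rw [← Complex.ofReal_pow, Real.sq_sqrt hN.le, Complex.ofReal_natCast]
  have hs0 : ((Real.sqrt N : ℝ) : ℂ) ≠ 0 := by
    exact_mod_cast (Real.sqrt_pos.mpr hN).ne'
  have hrC : (r : ℂ) ≠ 0 := by exact_mod_cast hr0
  refine ⟨(((r * Real.sqrt N)⁻¹ : ℝ) : ℂ) • V, ?_, ?_⟩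
  · intro φ ψ
    have hsm : ∀ (c : ℝ) (f g : ZMod N → ℂ),
        innerL2 N ((c : ℂ) • f) ((c : ℂ) • g) = (c : ℂ) ^ 2 * innerL2 N f g := by
      intro c f g
      simp only [innerL2, Pi.smul_apply, smul_eq_mul, map_mul, Finset.mul_sum, Complex.conj_ofReal]
      exact Finset.sum_congr rfl fun Q _ => by ring
    rw [LinearMap.smul_apply, LinearMap.smul_apply, hsm, hinv, ← hs]
    push_cast
    field_simp
  · intro n m hnm
    rw [T_eq_TZ, T_eq_TZ, hnm]
    refine LinearMap.ext fun φ => ?_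
    simp only [LinearMap.comp_apply, LinearMap.smul_apply, map_smul]
    rw [hVdef, avg_intertwines]

/-- Two quantizations of the same matrix differ by a phase; in particular they have the same
eigenfunctions. -/
theorem IsQuantization.unique {B : SpecialLinearGroup (Fin 2) (ZMod (2 * N))}
    {U U' : (ZMod N → ℂ) →ₗ[ℂ] (ZMod N → ℂ)}
    (hU : IsQuantization N B U) (hU' : IsQuantization N B U') :
    ∃ c : ℂ, ‖c‖ = 1 ∧ U' = c • U := by
  have hnorm : ∀ {V : (ZMod N → ℂ) →ₗ[ℂ] (ZMod N → ℂ)}, IsQuantization N B V →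
      ∀ φ, normL2 N (V φ) = normL2 N φ := by
    intro V hV φ
    have := hV.unitary φ φ
    rw [innerL2_self, innerL2_self, Complex.ofReal_inj] at this
    exact (sq_eq_sq₀ (Real.sqrt_nonneg _) (Real.sqrt_nonneg _)).mp this
  have hinj : Function.Injective U := by
    rw [injective_iff_map_eq_zero]
    intro φ hφ
    apply normL2_eq_zero
    rw [← hnorm hU, hφ]
    simp [normL2]
  let e := LinearEquiv.ofInjectiveEndo U hinj
  have he : ∀ φ, U (e.symm φ) = φ := fun φ => e.apply_symm_apply φ
  obtain ⟨c, hc⟩ := commutant N (e.symm.toLinearMap ∘ₗ U') (by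
    intro n φ
    obtain ⟨m, rfl⟩ := vecMul_surj N B n
    apply hinj
    simp only [LinearMap.comp_apply, LinearEquiv.coe_coe]
    rw [he, ← hU.intertwines, ← hU'.intertwines, he])
  have hUU : U' = c • U := by
    refine LinearMap.ext fun φ => ?_
    have := congrArg U (hc φ)
    simpa [he] using this
  refine ⟨c, ?_, hUU⟩
  have h1 := hnorm hU' (Pi.single 0 1)
  have h2 := hnorm hU (Pi.single 0 1)
  have h3 : ∀ φ : ZMod N → ℂ, normL2 N (c • φ) = ‖c‖ * normL2 N φ := by
    intro φ
    unfold normL2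
    have : (1 / (N : ℝ)) * ∑ Q, ‖(c • φ) Q‖ ^ 2 = ‖c‖ ^ 2 * ((1 / (N : ℝ)) * ∑ Q, ‖φ Q‖ ^ 2) := by
      simp only [Pi.smul_apply, smul_eq_mul, norm_mul, mul_pow, ← Finset.mul_sum]
      ring
    rw [this, Real.sqrt_mul (by positivity), Real.sqrt_sq (norm_nonneg c)]
  rw [hUU, LinearMap.smul_apply, h3, h2] at h1
  have h4 : normL2 N (Pi.single 0 1 : ZMod N → ℂ) ≠ 0 := by
    intro h
    have := congrFun (normL2_eq_zero N _ h) 0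
    simp at this
  exact mul_right_cancel₀ h4 (h1.trans (one_mul _).symm)

end Existence

/-- The quantization `U_N(B)` of a matrix `B` of the congruence group; for an integral matrix it
is the quantization of its reduction modulo `2N`. The exact Egorov property determines `U_N(B)` up
to a phase, on which its eigenfunctions do not depend. -/
noncomputable def quantization (N : ℕ) [NeZero N] (B : thetaGroup N) :
    (ZMod N → ℂ) →ₗ[ℂ] (ZMod N → ℂ) :=
  (exists_isQuantization B.2).choose

theorem quantization_spec (N : ℕ) [NeZero N] (B : thetaGroup N) :
    IsQuantization N B.1 (quantization N B) :=
  (exists_isQuantization B.2).choose_spec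

/-! ## Hecke operators and Hecke eigenfunctions -/

/-- The ring `𝔒/m𝔒`, where `𝔒 = ℤ[α]` and `α` is an eigenvalue of `A ∈ SL₂(ℤ)`. For hyperbolic `A`
the number `α` is a quadratic irrationality with minimal polynomial `X² - tr(A) X + 1`, so `𝔒` has
the `ℤ`-basis `1, α` with `α² = -1 + tr(A) α`, and `𝔒/m𝔒` has the `ℤ/mℤ`-basis `1, α` with the
same multiplication. -/
abbrev OrderMod (A : SpecialLinearGroup (Fin 2) ℤ) (m : ℕ) : Type :=
  QuadraticAlgebra (ZMod m) (-1) (A.1.trace : ZMod m)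

/-- The group `𝒯^θ(2N)`: the elements of `𝔒/2N𝔒` of norm `1` (in `ℤ/2Nℤ`) that are congruent to
`1` modulo `4𝔒` if `N` is even, and modulo `2𝔒` if `N` is odd. -/
def torusTheta (A : SpecialLinearGroup (Fin 2) ℤ) (N : ℕ) : Set (OrderMod A (2 * N)) :=
  {β | QuadraticAlgebra.norm β = 1 ∧
    ∃ γ : OrderMod A (2 * N), β = 1 + (level N : OrderMod A (2 * N)) * γ}

/-- The map `ι : 𝔒/m𝔒 → Mat₂(ℤ/mℤ)`, `x + yα ↦ x + yA`. (If `v A = α v`, this is the matrix of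
multiplication by `x + yα` in the basis `v₁, v₂`.) -/
def iota (A : SpecialLinearGroup (Fin 2) ℤ) (m : ℕ) (β : OrderMod A m) :
    Matrix (Fin 2) (Fin 2) (ZMod m) :=
  β.re • (1 : Matrix (Fin 2) (Fin 2) (ZMod m)) + β.im • A.1.map (Int.cast : ℤ → ZMod m)

theorem det_iota (A : SpecialLinearGroup (Fin 2) ℤ) (m : ℕ) (β : OrderMod A m) :
    (iota A m β).det = QuadraticAlgebra.norm β := by
  have h : ((A.1.det : ℤ) : ZMod m) = 1 := by rw [A.2]; simp
  rw [Matrix.det_fin_two] at h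
  push_cast at h
  have ht : ((A.1.trace : ℤ) : ZMod m) = A.1 0 0 + A.1 1 1 := by
    rw [Matrix.trace_fin_two]; push_cast; rfl
  rw [QuadraticAlgebra.norm_def, Matrix.det_fin_two]
  simp only [iota, Matrix.add_apply, Matrix.smul_apply, Matrix.map_apply, smul_eq_mul,
    Matrix.one_apply_eq, ne_eq, zero_ne_one, one_ne_zero, not_false_eq_true, Matrix.one_apply_ne]
  linear_combination (-β.re * β.im) * ht + β.im ^ 2 * h

/-- The image `ι(β)` of `β ∈ 𝒯^θ(2N)`, as an element of the congruence group. -/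
def heckeMatrix (A : SpecialLinearGroup (Fin 2) ℤ) (N : ℕ) (β : torusTheta A N) : thetaGroup N :=
  ⟨⟨iota A (2 * N) β.1, (det_iota A (2 * N) β.1).trans β.2.1⟩, by
    obtain ⟨γ, hγ⟩ := β.2.2
    refine ⟨iota A (2 * N) γ, ?_⟩
    have hre : β.1.re = 1 + (level N : ZMod (2 * N)) * γ.re := by
      rw [hγ]; simp [QuadraticAlgebra.re_one]
    have him : β.1.im = (level N : ZMod (2 * N)) * γ.im := by
      rw [hγ]; simp [QuadraticAlgebra.im_one]
    show iota A (2 * N) β.1 = _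
    simp only [iota, hre, him, smul_add, smul_smul, add_smul, one_smul, add_assoc]⟩

/-- A Hecke eigenfunction: a nonzero `ψ ∈ L²(ℤ/Nℤ)` that is a simultaneous eigenfunction of all the
Hecke operators `U_N(ι(β))`, `β ∈ 𝒯^θ(2N)`. -/
def IsHeckeEigenfunction (A : SpecialLinearGroup (Fin 2) ℤ) (N : ℕ) [NeZero N]
    (ψ : ZMod N → ℂ) : Prop :=
  ψ ≠ 0 ∧ ∀ β : torusTheta A N, ∃ c : ℂ, quantization N (heckeMatrix A N β) ψ = c • ψ

end CatMap

/-! The proof is a duality argument. Let `U_s` be Hecke operators with `U_s ψ = c_s ψ`, and let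
`δ_Q` be a position state. Pairing `ψ` with `∑ conj(c_s) U_s δ_Q` gives `|S| ψ(Q) / N`, so
Cauchy–Schwarz bounds `|S|² |ψ(Q)|²` by `N² ∑_{s,r} |⟨U_s δ_Q, U_r δ_Q⟩|`
(`normSq_apply_le_of_eigenvector`). Up to a phase each term is a diagonal coefficient of the
quantization of a quotient of torus elements. If that quotient has lower-left entry `c`, the term is
at most `N^{-3/2} gcd(N, c)^{1/2}`, because the Egorov property makes the modulus of the image of
`δ_Q` invariant under translation by `c` (`IsQuantization.normSq_apply_single_le`).

It remains to find many torus elements whose quotients rarely have `c` sharing a large factor with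
`N`. In the spirit of Hilbert 90 take `β_s = δ_s / δ̄_s` with `δ_s = 1 + 4sα`. For `β_s / β_r` the
entry is, up to a unit, `8 A₁₀ (s - r)` times a form that is affine in `s` for fixed `r`, so the
gcds average to `O(τ(N))` (`exists_family`, `sum_gcd_affine_le`). The norm of `δ_s` is a unit for at
least `N / τ(N)²` residues `s` (`le_unitCount_mul`). Altogether `|ψ(Q)|² ≪ N^{1/2} τ(N)³`, which
even yields the exponent `1/4 + ε`. -/

namespace CatMap

/-! ## Arithmetic input -/

/-- The divisor bound `τ(n) ≪ n^ε`. -/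
theorem exists_card_divisors_le_rpow {ε : ℝ} (hε : 0 < ε) :
    ∃ C : ℝ, 0 < C ∧ ∀ n : ℕ, n ≠ 0 → (n.divisors.card : ℝ) ≤ C * (n : ℝ) ^ ε := by
  -- Primes `p ≥ P` satisfy `p ^ ε ≥ 2` and lose nothing; each of the fewer than `P` smaller primes
  -- loses a factor `K`.
  obtain ⟨P, hP⟩ := exists_nat_ge ((2 : ℝ) ^ (1 / ε))
  have hl : 0 < ε * Real.log 2 := mul_pos hε (Real.log_pos one_lt_two)
  set K : ℝ := 1 + 1 / (ε * Real.log 2) with hK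
  -- This `K` gives `e + 1 ≤ K (1 + e ε log 2) ≤ K · 2^{εe}`.
  have hK1 : 1 ≤ K := by rw [hK]; linarith [one_div_pos.mpr hl]
  refine ⟨K ^ P, by positivity, fun n hn => ?_⟩
  have hfac : (n : ℝ) ^ ε = ∏ p ∈ n.primeFactors, ((p : ℝ) ^ ε) ^ n.factorization p := by
    have h1 : (n : ℝ) = ∏ p ∈ n.primeFactors, (p : ℝ) ^ n.factorization p := by
      conv_lhs => rw [← Nat.prod_factorization_pow_eq_self hn]
      rw [Finsupp.prod, Nat.support_factorization]
      push_cast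
      rfl
    conv_lhs => rw [h1]
    rw [← Real.finsetProd_rpow _ _ fun p _ => by positivity]
    refine Finset.prod_congr rfl fun p _ => ?_
    rw [← Real.rpow_natCast, ← Real.rpow_natCast, ← Real.rpow_mul (by positivity),
      ← Real.rpow_mul (by positivity), mul_comm]
  have hlocal : ∀ p ∈ n.primeFactors, ((n.factorization p + 1 : ℕ) : ℝ) ≤
      (if p < P then K else 1) * ((p : ℝ) ^ ε) ^ n.factorization p := by
    intro p hp
    have hp2 : (2 : ℝ) ≤ p := by exact_mod_cast (Nat.prime_of_mem_primeFactors hp).two_le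
    generalize n.factorization p = e
    split_ifs with h
    · have h1 : 1 + e * (ε * Real.log 2) ≤ ((2 : ℝ) ^ ε) ^ e := by
        rw [← Real.rpow_natCast, ← Real.rpow_mul zero_le_two, Real.rpow_def_of_pos two_pos]
        have := Real.add_one_le_exp (Real.log 2 * (ε * e))
        linarith
      have h2 : ((2 : ℝ) ^ ε) ^ e ≤ ((p : ℝ) ^ ε) ^ e := by gcongr
      have h3 : ((e + 1 : ℕ) : ℝ) ≤ K * (1 + e * (ε * Real.log 2)) := by
        have : K * (1 + e * (ε * Real.log 2)) =
            1 + e + e * (ε * Real.log 2) + 1 / (ε * Real.log 2) := by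
          rw [hK]; field_simp; ring
        rw [this]
        push_cast
        have : 0 ≤ e * (ε * Real.log 2) := by positivity
        linarith [one_div_pos.mpr hl]
      exact h3.trans (mul_le_mul_of_nonneg_left (h1.trans h2) (by positivity))
    · have h1 : (2 : ℝ) ≤ (p : ℝ) ^ ε := by
        have h2 : (2 : ℝ) ^ (1 / ε) ≤ p := hP.trans (by exact_mod_cast not_lt.mp h)
        have h3 := Real.rpow_le_rpow (by positivity) h2 hε.le
        rwa [← Real.rpow_mul zero_le_two, one_div_mul_cancel hε.ne', Real.rpow_one] at h3
      have h2 : ((e + 1 : ℕ) : ℝ) ≤ 2 ^ e := by exact_mod_cast Nat.lt_two_pow_self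
      rw [one_mul]
      exact h2.trans (by gcongr)
  rw [Nat.card_divisors hn, hfac]
  push_cast at hlocal ⊢
  refine (Finset.prod_le_prod (fun p _ => by positivity) hlocal).trans ?_
  rw [Finset.prod_mul_distrib]
  refine mul_le_mul_of_nonneg_right ?_ (by positivity)
  rw [Finset.prod_ite, Finset.prod_const, Finset.prod_const_one, mul_one]
  refine pow_le_pow_right₀ hK1 ?_
  calc _ ≤ (Finset.range P).card := Finset.card_le_card fun p hp => by
        simpa using (Finset.mem_filter.mp hp).2
    _ = P := Finset.card_range P

/-! ### Averages of gcds along affine forms -/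

/-- An affine congruence `e ∣ m s + b` with `gcd(m, b) ∣ K` has at most `K N / e` solutions
modulo a multiple `N` of `e`. -/
lemma card_dvd_affine_le {N e : ℕ} (hN : N ≠ 0) (he : e ∣ N) (m b : ℤ) {K : ℕ} (hK : K ≠ 0)
    (hmb : (Int.gcd m b) ∣ K) :
    e * ((Finset.range N).filter fun s : ℕ => (e : ℤ) ∣ m * s + b).card ≤ K * N := by
  have he0 : 0 < e := Nat.pos_of_dvd_of_pos he (Nat.pos_of_ne_zero hN)
  -- All solutions will lie in one residue class modulo `q = e / gcd(e, K)`.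
  obtain ⟨q, hq⟩ : Nat.gcd e K ∣ e := Nat.gcd_dvd_left e K
  set g := Nat.gcd e K with hg
  have hg0 : 0 < g := Nat.gcd_pos_of_pos_left _ he0
  have hgK : g ≤ K := Nat.le_of_dvd (Nat.pos_of_ne_zero hK) (Nat.gcd_dvd_right e K)
  have hqN : q ∣ N := (Dvd.intro_left g hq.symm).trans he
  have hq0 : 0 < q := Nat.pos_of_dvd_of_pos hqN (Nat.pos_of_ne_zero hN)
  have hcong : ∀ s r : ℕ, (e : ℤ) ∣ m * s + b → (e : ℤ) ∣ m * r + b → s ≡ r [MOD q] := by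
    intro s r hs hr
    have h1 : (e : ℤ) ∣ m * (s - r) := by
      have := dvd_sub hs hr
      rwa [show m * s + b - (m * r + b) = m * (s - r) by ring] at this
    -- Eliminating `m` from the two congruences; Bézout for `m, b` then replaces both coefficients
    -- by `K`.
    have h2 : (e : ℤ) ∣ b * (s - r) := by
      have := dvd_sub (hr.mul_left (s : ℤ)) (hs.mul_left (r : ℤ))
      rwa [show s * (m * r + b) - r * (m * s + b) = b * (s - r) by ring] at this
    have h3 : (e : ℤ) ∣ K * (s - r) := by
      obtain ⟨k, hk⟩ := hmb
      have hb := Int.gcd_eq_gcd_ab m b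
      have : (K : ℤ) * (s - r) =
          k * (Int.gcdA m b * (m * (s - r)) + Int.gcdB m b * (b * (s - r))) := by
        rw [hk]; push_cast; rw [hb]; ring
      rw [this]
      exact ((h1.mul_left _).add (h2.mul_left _)).mul_left _
    have h4 : (e : ℤ) ∣ g * (s - r) := by
      rw [hg, Nat.gcd_eq_gcd_ab e K]
      have : ((e : ℤ) * Nat.gcdA e K + K * Nat.gcdB e K) * (s - r) =
          e * (Nat.gcdA e K * (s - r)) + Nat.gcdB e K * (K * (s - r)) := by ring
      rw [this]
      exact (dvd_mul_right _ _).add (h3.mul_left _)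
    rw [hq] at h4
    push_cast at h4
    have h5 := Int.dvd_of_mul_dvd_mul_left (by exact_mod_cast hg0.ne') h4
    exact ((Nat.modEq_iff_dvd).mpr h5).symm
  have hcard : ((Finset.range N).filter fun s : ℕ => (e : ℤ) ∣ m * s + b).card ≤ N / q := by
    rw [← Finset.card_range (N / q)]
    refine Finset.card_le_card_of_injOn (fun s => s / q) ?_ ?_
    · intro s hs
      simp only [Finset.coe_filter, Finset.mem_range, Set.mem_ofPred_eq] at hs
      simp only [Finset.coe_range, Set.mem_Iio]
      exact Nat.div_lt_div_of_lt_of_dvd hqN hs.1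
    · intro s hs r hr hsr
      simp only [Finset.coe_filter, Finset.mem_range, Set.mem_ofPred_eq] at hs hr
      have h1 : s % q = r % q := hcong s r hs.2 hr.2
      have h2 : s / q = r / q := hsr
      rw [← Nat.div_add_mod s q, ← Nat.div_add_mod r q, h1, h2]
  calc _ ≤ e * (N / q) := Nat.mul_le_mul_left _ hcard
    _ = g * N := by
      conv_lhs => rw [hq]
      rw [mul_assoc, Nat.mul_div_cancel' hqN]
    _ ≤ K * N := Nat.mul_le_mul_right _ hgK

/-- The average of `gcd(N, m s + b)` over `s` modulo `N` is at most `K τ(N)` if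
`gcd(m, b) ∣ K`. -/
lemma sum_gcd_affine_le {N : ℕ} (hN : N ≠ 0) (m b : ℤ) {K : ℕ} (hK : K ≠ 0)
    (hmb : (Int.gcd m b) ∣ K) :
    ∑ s ∈ Finset.range N, Int.gcd N (m * s + b) ≤ K * N * N.divisors.card := by
  -- The gcd is itself one of the common divisors `e` summed on the right.
  have h : ∀ s : ℕ, Int.gcd N (m * s + b) ≤
      ∑ e ∈ N.divisors, if (e : ℤ) ∣ m * s + b then e else 0 := by
    intro s
    have hmem : Int.gcd N (m * s + b) ∈ N.divisors :=
      Nat.mem_divisors.mpr ⟨Int.natCast_dvd_natCast.mp (Int.gcd_dvd_left _ _), hN⟩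
    refine le_trans ?_ (Finset.single_le_sum (fun _ _ => Nat.zero_le _) hmem)
    rw [if_pos (Int.gcd_dvd_right _ _)]
  calc _ ≤ ∑ s ∈ Finset.range N, ∑ e ∈ N.divisors, if (e : ℤ) ∣ m * s + b then e else 0 :=
        Finset.sum_le_sum fun s _ => h s
    _ = ∑ e ∈ N.divisors,
          e * ((Finset.range N).filter fun s : ℕ => (e : ℤ) ∣ m * s + b).card := by
        rw [Finset.sum_comm]
        refine Finset.sum_congr rfl fun e _ => ?_
        rw [← Finset.sum_filter, Finset.sum_const, smul_eq_mul, mul_comm]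
    _ ≤ ∑ _e ∈ N.divisors, K * N :=
        Finset.sum_le_sum fun e he => card_dvd_affine_le hN (Nat.dvd_of_mem_divisors he) m b hK hmb
    _ = _ := by rw [Finset.sum_const, smul_eq_mul, mul_comm]

/-! ### Counting the `s` for which the norm is a unit -/

/-- The number of `s` modulo `N` for which `1 + 4ts + 16s²` is a unit. -/
noncomputable def unitCount (t : ℤ) (N : ℕ) : ℕ :=
  Nat.card {s : ZMod N // IsUnit (1 + 4 * (t : ZMod N) * s + 16 * s ^ 2)}

lemma unitCount_mul (t : ℤ) {a b : ℕ} (hab : a.Coprime b) :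
    unitCount t (a * b) = unitCount t a * unitCount t b := by
  unfold unitCount
  rw [← Nat.card_prod]
  let φ := ZMod.chineseRemainder hab
  refine Nat.card_congr ((φ.toEquiv.subtypeEquiv fun s => ?_).trans
    (Equiv.subtypeProdEquivProd (p := fun s : ZMod a => IsUnit (1 + 4 * (t : ZMod a) * s + 16 * s ^ 2))
      (q := fun s : ZMod b => IsUnit (1 + 4 * (t : ZMod b) * s + 16 * s ^ 2))))
  rw [← MulEquiv.isUnit_map φ, Prod.isUnit_iff]
  have h1 : (φ (t : ZMod (a * b))) = ((t : ZMod a × ZMod b)) := map_intCast φ t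
  have h4 : φ 4 = 4 := map_ofNat φ 4
  have h16 : φ 16 = 16 := map_ofNat φ 16
  simp only [map_add, map_mul, map_pow, map_one, h1, h4, h16]
  rfl

/-- Among `s, s + 1, s + 2`, one is not a root of `1 + 4ts + 16s²` modulo a given prime. -/
lemma prime_not_dvd_of_shift {p : ℕ} (hp : p.Prime) (t s : ℤ) :
    ∃ i ∈ Finset.range 3, ¬ (p : ℤ) ∣ 1 + 4 * t * (s + i) + 16 * (s + i) ^ 2 := by
  by_contra! h
  have h0 := h 0 (by simp)
  have h1 := h 1 (by simp)
  have h2 := h 2 (by simp)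
  push_cast at h0 h1 h2
  -- The second difference of `1 + 4ts + 16s²` is 32.
  have h32 : (p : ℤ) ∣ 2 ^ 5 := by
    have := (h0.add h2).sub (h1.mul_left 2)
    ring_nf at this
    exact this
  have hp2 : (p : ℤ) ∣ 2 := (Nat.prime_iff_prime_int.mp hp).dvd_of_dvd_pow h32
  -- The only prime left is 2, and the quadratic takes odd values.
  have : (p : ℤ) ∣ 1 := by
    have := dvd_sub h0 (hp2.mul_right (2 * t * s + 8 * s ^ 2))
    ring_nf at this
    exact this
  exact hp.one_lt.ne' (by exact_mod_cast Int.eq_one_of_dvd_one (by positivity) this)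

lemma isUnit_intCast_iff (N : ℕ) (j : ℤ) : IsUnit (j : ZMod N) ↔ IsCoprime j N := by
  exact ZMod.coe_int_isUnit_iff_isCoprime j N |>.trans isCoprime_comm

/-- Being a unit modulo `p ^ k` depends only on the residue modulo `p`, so by
`prime_not_dvd_of_shift` three translates of the set of good `s` cover `ℤ/p^k`. -/
lemma le_three_mul_unitCount_prime_pow (t : ℤ) {p k : ℕ} (hp : p.Prime) :
    p ^ k ≤ 3 * unitCount t (p ^ k) := by
  classical
  have : NeZero (p ^ k) := ⟨pow_ne_zero _ hp.ne_zero⟩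
  unfold unitCount
  rw [Nat.card_eq_fintype_card, Fintype.card_subtype]
  set S := Finset.univ.filter fun s : ZMod (p ^ k) =>
    IsUnit (1 + 4 * (t : ZMod (p ^ k)) * s + 16 * s ^ 2) with hS
  have hcov : (Finset.univ : Finset (ZMod (p ^ k))) ⊆
      (Finset.range 3).biUnion fun i => S.image fun s => s - (i : ZMod (p ^ k)) := by
    intro x _
    obtain ⟨s, rfl⟩ := ZMod.intCast_surjective x
    obtain ⟨i, hi, h⟩ := prime_not_dvd_of_shift hp t s
    rw [Finset.mem_biUnion]
    refine ⟨i, hi, Finset.mem_image.mpr ⟨s + i, ?_, by ring⟩⟩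
    rw [hS, Finset.mem_filter]
    refine ⟨Finset.mem_univ _, ?_⟩
    have hc : IsCoprime (1 + 4 * t * (s + i) + 16 * (s + i) ^ 2) (((p ^ k : ℕ)) : ℤ) := by
      push_cast
      refine IsCoprime.pow_right ?_
      rw [isCoprime_comm]
      exact ((Nat.prime_iff_prime_int.mp hp).coprime_iff_not_dvd).mpr h
    have := (isUnit_intCast_iff _ _).mpr hc
    push_cast at this
    exact this
  calc p ^ k = (Finset.univ : Finset (ZMod (p ^ k))).card := by
        rw [Finset.card_univ, ZMod.card]
    _ ≤ _ := Finset.card_le_card hcov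
    _ ≤ ∑ i ∈ Finset.range 3, (S.image fun s => s - (i : ZMod (p ^ k))).card :=
        Finset.card_biUnion_le
    _ ≤ ∑ _i ∈ Finset.range 3, S.card := Finset.sum_le_sum fun _ _ => Finset.card_image_le
    _ = 3 * S.card := by simp

/-- `1 + 4ts + 16s²` is a unit for at least `N / τ(N)²` residues `s` modulo `N`. -/
lemma le_unitCount_mul (t : ℤ) (N : ℕ) : N ≤ unitCount t N * N.divisors.card ^ 2 := by
  induction N using Nat.recOnPosPrimePosCoprime with
  | zero => simp
  | one =>
    have : unitCount t 1 = 1 := by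
      unfold unitCount
      rw [Nat.card_eq_one_iff_unique]
      refine ⟨⟨fun a b => Subtype.ext (Subsingleton.elim _ _)⟩, ⟨0, ?_⟩⟩
      simp
    simp [this]
  | prime_pow p k hp hk =>
    refine (le_three_mul_unitCount_prime_pow t hp).trans ?_
    rw [Nat.divisors_prime_pow hp, Finset.card_map, Finset.card_range, mul_comm]
    -- The loss of 3 at each prime is absorbed by `τ(p^k)² = (k + 1)² ≥ 4`, which makes the bound
    -- multiplicative.
    refine Nat.mul_le_mul_left _ ?_
    nlinarith
  | coprime a b ha hb hab iha ihb =>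
    rw [unitCount_mul t hab, hab.card_divisors_mul]
    calc a * b ≤ _ := Nat.mul_le_mul iha ihb
      _ = _ := by ring

end CatMap

namespace CatMap

/-! ## Translates of position states under Hecke operators -/

section Quantum

variable {N : ℕ} [NeZero N]

lemma IsQuantization.comp {B B' : SpecialLinearGroup (Fin 2) (ZMod (2 * N))}
    {U V : (ZMod N → ℂ) →ₗ[ℂ] (ZMod N → ℂ)}
    (hU : IsQuantization N B U) (hV : IsQuantization N B' V) :
    IsQuantization N (B * B') (U ∘ₗ V) := by
  refine ⟨fun φ ψ => by simp only [LinearMap.comp_apply, hU.unitary, hV.unitary], ?_⟩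
  intro n m hnm
  rw [T_eq_TZ, T_eq_TZ, hnm]
  refine LinearMap.ext fun φ => ?_
  simp only [LinearMap.comp_apply]
  rw [hU.intertwines, hV.intertwines, Matrix.vecMul_vecMul]
  rfl

lemma IsQuantization.normL2_apply {B : SpecialLinearGroup (Fin 2) (ZMod (2 * N))}
    {U : (ZMod N → ℂ) →ₗ[ℂ] (ZMod N → ℂ)} (hU : IsQuantization N B U) (φ : ZMod N → ℂ) :
    normL2 N (U φ) = normL2 N φ := by
  have := hU.unitary φ φ
  rw [innerL2_self, innerL2_self, Complex.ofReal_inj] at this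
  exact (sq_eq_sq₀ (Real.sqrt_nonneg _) (Real.sqrt_nonneg _)).mp this

lemma normL2_smul (c : ℂ) (φ : ZMod N → ℂ) : normL2 N (c • φ) = ‖c‖ * normL2 N φ := by
  unfold normL2
  have : (1 / (N : ℝ)) * ∑ Q, ‖(c • φ) Q‖ ^ 2 = ‖c‖ ^ 2 * ((1 / (N : ℝ)) * ∑ Q, ‖φ Q‖ ^ 2) := by
    simp only [Pi.smul_apply, smul_eq_mul, norm_mul, mul_pow, ← Finset.mul_sum]
    ring
  rw [this, Real.sqrt_mul (by positivity), Real.sqrt_sq (norm_nonneg c)]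

lemma normL2_sq (φ : ZMod N → ℂ) : normL2 N φ ^ 2 = (1 / (N : ℝ)) * ∑ Q, ‖φ Q‖ ^ 2 := by
  unfold normL2
  rw [Real.sq_sqrt (by positivity)]

lemma innerL2_single (φ : ZMod N → ℂ) (Q : ZMod N) :
    innerL2 N φ (Pi.single Q 1) = φ Q / N := by
  unfold innerL2
  rw [Finset.sum_eq_single Q]
  · simp; ring
  · intro x _ hx
    simp [hx]
  · simp

lemma sum_normSq_single (Q : ZMod N) :
    ∑ x, ‖(Pi.single Q 1 : ZMod N → ℂ) x‖ ^ 2 = 1 := by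
  rw [Finset.sum_eq_single Q]
  · simp
  · intro x _ hx
    simp [hx]
  · simp

/-! ### Diagonal matrix coefficients in the position basis -/

/-- The modulus of the image of a position state under the quantization of `B = (a b; c d)` is
invariant under translation by `c`. -/
lemma IsQuantization.norm_apply_single_add {B : SpecialLinearGroup (Fin 2) (ZMod (2 * N))}
    {U : (ZMod N → ℂ) →ₗ[ℂ] (ZMod N → ℂ)} (hU : IsQuantization N B U) (Q x : ZMod N) :
    ‖U (Pi.single Q 1) (x + red N (B.1 1 0))‖ = ‖U (Pi.single Q 1) x‖ := by
  have hnorm : ∀ (M : ℕ) [NeZero M] (y : ZMod M), ‖(ZMod.stdAddChar y : ℂ)‖ = 1 :=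
    fun M _ y => by rw [ZMod.stdAddChar_apply]; exact Circle.norm_coe _
  -- `T(0, 1)` acts on a position state by a phase. The preimage of `(0, 1)` under `B` is `(-c, a)`,
  -- and `T(-c, a)` is translation by `-c` up to phases.
  have hv : ![-B.1 1 0, B.1 0 0] ᵥ* B.1 = ![0, 1] := by
    have h := B.2
    rw [Matrix.det_fin_two] at h
    funext i
    fin_cases i
    · simp [Matrix.vecMul, dotProduct, Fin.sum_univ_two]; ring
    · simp only [Matrix.vecMul, dotProduct, Fin.sum_univ_two]
      simp
      linear_combination h
  have h := congrFun (hU.intertwines ![-B.1 1 0, B.1 0 0] (Pi.single Q 1))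
    (x + red N (B.1 1 0))
  rw [hv, TZ_single, map_smul, TZ_apply] at h
  have h' := congrArg norm h
  simp only [norm_mul, hnorm, Pi.smul_apply, smul_eq_mul, one_mul, Matrix.cons_val_zero,
    Matrix.cons_val_one, map_neg, map_zero, sub_zero] at h'
  rw [add_neg_cancel_right] at h'
  exact h'.symm

/-- A function on `ℤ/Nℤ` whose modulus is invariant under translation by `b` has
`|φ(Q)|² ≤ gcd(N, k)/N · ∑ |φ|²` whenever `k` is a multiple of `b` modulo `N`. -/
lemma normSq_le_gcd_of_invariant (φ : ZMod N → ℂ) (b : ZMod N)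
    (hφ : ∀ x, ‖φ (x + b)‖ = ‖φ x‖) (w : ZMod N) (k : ℤ) (hk : w * b = k) (Q : ZMod N) :
    N * ‖φ Q‖ ^ 2 ≤ Int.gcd N k * ∑ x, ‖φ x‖ ^ 2 := by
  set d := addOrderOf b with hd
  have hd0 : 0 < d := addOrderOf_pos b
  have hiter : ∀ i : ℕ, ‖φ (Q + i • b)‖ = ‖φ Q‖ := by
    intro i
    induction i with
    | zero => simp
    | succ i ih => rw [succ_nsmul, ← add_assoc, hφ, ih]
  have horb : d * ‖φ Q‖ ^ 2 ≤ ∑ x, ‖φ x‖ ^ 2 := by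
    have hinj : Set.InjOn (fun i : ℕ => Q + i • b) (Finset.range d) := by
      intro i hi j hj hij
      simp only [Finset.coe_range] at hi hj
      exact nsmul_injOn_Iio_addOrderOf hi hj (add_left_cancel hij)
    calc d * ‖φ Q‖ ^ 2 = ∑ i ∈ Finset.range d, ‖φ (Q + i • b)‖ ^ 2 := by
          rw [Finset.sum_congr rfl fun i _ => by rw [hiter i], Finset.sum_const, Finset.card_range,
            nsmul_eq_mul]
      _ = ∑ x ∈ (Finset.range d).image fun i : ℕ => Q + i • b, ‖φ x‖ ^ 2 :=
          (Finset.sum_image (f := fun x => ‖φ x‖ ^ 2) hinj).symm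
      _ ≤ _ := Finset.sum_le_sum_of_subset_of_nonneg (Finset.subset_univ _)
          fun _ _ _ => by positivity
  -- From `d b = 0` follows `N ∣ d k`, hence `N ∣ d gcd(N, k)`.
  have hNd : N ≤ Int.gcd N k * d := by
    have h1 : ((d * k : ℤ) : ZMod N) = 0 := by
      have := addOrderOf_nsmul_eq_zero b
      rw [← hd, nsmul_eq_mul] at this
      push_cast
      rw [← hk]
      linear_combination w * this
    rw [ZMod.intCast_zmod_eq_zero_iff_dvd] at h1
    have h2 : N ∣ d * k.natAbs := by
      have := Int.natAbs_dvd_natAbs.mpr h1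
      rwa [Int.natAbs_mul, Int.natAbs_natCast, Int.natAbs_natCast] at this
    have h3 : N ∣ d * Nat.gcd N k.natAbs := by
      rw [← Nat.gcd_mul_left]
      exact Nat.dvd_gcd (dvd_mul_left _ _) h2
    have h4 : 0 < Nat.gcd N k.natAbs := Nat.gcd_pos_of_pos_left _ (NeZero.pos N)
    have := Nat.le_of_dvd (by positivity) h3
    rw [mul_comm] at this
    simpa [Int.gcd] using this
  calc (N : ℝ) * ‖φ Q‖ ^ 2 ≤ (Int.gcd N k * d : ℕ) * ‖φ Q‖ ^ 2 := by gcongr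
    _ = Int.gcd N k * (d * ‖φ Q‖ ^ 2) := by push_cast; ring
    _ ≤ _ := by gcongr

/-- Diagonal matrix coefficients of the quantization of `B = (a b; c d)` in the position basis:
`|⟨U δ_Q, δ_Q⟩|² ≤ gcd(N, c)/N`. -/
lemma IsQuantization.normSq_apply_single_le {B : SpecialLinearGroup (Fin 2) (ZMod (2 * N))}
    {U : (ZMod N → ℂ) →ₗ[ℂ] (ZMod N → ℂ)} (hU : IsQuantization N B U) (Q : ZMod N)
    (w : ZMod (2 * N)) (k : ℤ) (hk : w * B.1 1 0 = k) :
    N * ‖U (Pi.single Q 1) Q‖ ^ 2 ≤ Int.gcd N k := by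
  have hsum : ∑ x, ‖U (Pi.single Q 1) x‖ ^ 2 = 1 := by
    have h := congrArg (· ^ 2) (hU.normL2_apply (Pi.single Q 1))
    have hN : (N : ℝ) ≠ 0 := by exact_mod_cast NeZero.ne N
    simp only [normL2_sq, sum_normSq_single] at h
    exact mul_left_cancel₀ (one_div_ne_zero hN) h
  have h := normSq_le_gcd_of_invariant (U (Pi.single Q 1)) (red N (B.1 1 0))
    (hU.norm_apply_single_add Q) (red N w) k (by rw [← map_mul, hk, red_int]) Q
  rwa [hsum, mul_one] at h

/-! ### Cauchy–Schwarz and duality -/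

lemma norm_innerL2_le (φ ψ : ZMod N → ℂ) : ‖innerL2 N φ ψ‖ ≤ normL2 N φ * normL2 N ψ := by
  have hN : (0 : ℝ) < N := by exact_mod_cast NeZero.pos N
  have h1 : ‖∑ Q, φ Q * (starRingEnd ℂ) (ψ Q)‖ ≤
      Real.sqrt (∑ Q, ‖φ Q‖ ^ 2) * Real.sqrt (∑ Q, ‖ψ Q‖ ^ 2) := by
    refine (norm_sum_le _ _).trans ?_
    simp only [norm_mul, RCLike.norm_conj]
    exact Real.sum_mul_le_sqrt_mul_sqrt _ _ _
  unfold innerL2 normL2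
  rw [norm_mul, Real.sqrt_mul (by positivity), Real.sqrt_mul (by positivity)]
  have h2 : ‖(1 / (N : ℂ))‖ = Real.sqrt (1 / N) * Real.sqrt (1 / N) := by
    rw [Real.mul_self_sqrt (by positivity)]
    simp
  rw [h2]
  calc _ ≤ Real.sqrt (1 / N) * Real.sqrt (1 / N) *
        (Real.sqrt (∑ Q, ‖φ Q‖ ^ 2) * Real.sqrt (∑ Q, ‖ψ Q‖ ^ 2)) := by gcongr
    _ = _ := by ring

lemma innerL2_sum_smul {ι : Type*} (S : Finset ι) (c d : ι → ℂ) (f g : ι → ZMod N → ℂ) :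
    innerL2 N (∑ j ∈ S, c j • f j) (∑ k ∈ S, d k • g k) =
      ∑ j ∈ S, ∑ k ∈ S, c j * (starRingEnd ℂ) (d k) * innerL2 N (f j) (g k) := by
  simp only [innerL2, Finset.sum_apply, Pi.smul_apply, smul_eq_mul, map_sum, map_mul,
    Finset.sum_mul_sum]
  simp only [Finset.mul_sum]
  rw [Finset.sum_comm]
  refine Finset.sum_congr rfl fun j _ => ?_
  rw [Finset.sum_comm]
  exact Finset.sum_congr rfl fun k _ => Finset.sum_congr rfl fun x _ => by ring

/-- The duality inequality: a joint eigenvector of unitary operators `U_s` is small at `Q` if the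
vectors `U_s δ_Q` are almost orthogonal. -/
lemma normSq_apply_le_of_eigenvector {ι : Type*} (S : Finset ι)
    (U : ι → (ZMod N → ℂ) →ₗ[ℂ] (ZMod N → ℂ))
    (hU : ∀ s φ ψ, innerL2 N (U s φ) (U s ψ) = innerL2 N φ ψ) {ψ : ZMod N → ℂ}
    (hψ : normL2 N ψ = 1) (hev : ∀ s, ∃ c : ℂ, U s ψ = c • ψ) (Q : ZMod N) :
    (S.card : ℝ) ^ 2 * ‖ψ Q‖ ^ 2 ≤ N ^ 2 *
      ∑ s ∈ S, ∑ r ∈ S, ‖innerL2 N (U s (Pi.single Q 1)) (U r (Pi.single Q 1))‖ := by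
  choose c hc using hev
  have hN : (N : ℝ) ≠ 0 := by exact_mod_cast NeZero.ne N
  have hc1 : ∀ s, ‖c s‖ = 1 := by
    intro s
    have h := hU s ψ ψ
    rw [innerL2_self, innerL2_self, hc, normL2_smul, hψ, Complex.ofReal_inj] at h
    rw [mul_one, one_pow] at h
    exact (pow_eq_one_iff_of_nonneg (norm_nonneg _) two_ne_zero).mp h
  set e : ZMod N → ℂ := Pi.single Q 1 with he
  -- The coefficients undo the eigenvalue phases, so that every term contributes the same `ψ Q / N`
  -- to `⟨ψ, v⟩`.
  set v : ZMod N → ℂ := ∑ s ∈ S, (starRingEnd ℂ) (c s) • U s e with hv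
  have h1 : innerL2 N ψ v = S.card * (ψ Q / N) := by
    have hterm : ∀ s, c s * innerL2 N ψ (U s e) = ψ Q / N := by
      intro s
      rw [← innerL2_single, ← he, ← hU s ψ e, hc]
      simp only [innerL2, Pi.smul_apply, smul_eq_mul, Finset.mul_sum]
      exact Finset.sum_congr rfl fun x _ => by ring
    calc innerL2 N ψ v = ∑ s ∈ S, c s * innerL2 N ψ (U s e) := by
          simp only [hv, innerL2, Finset.sum_apply, Pi.smul_apply, smul_eq_mul, map_sum, map_mul,
            Complex.conj_conj, Finset.mul_sum]
          rw [Finset.sum_comm]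
          exact Finset.sum_congr rfl fun s _ => Finset.sum_congr rfl fun x _ => by ring
      _ = _ := by simp [hterm]
  have h2 : normL2 N v ^ 2 ≤ ∑ s ∈ S, ∑ r ∈ S, ‖innerL2 N (U s e) (U r e)‖ := by
    have h3 : ‖innerL2 N v v‖ = normL2 N v ^ 2 := by
      rw [innerL2_self, Complex.norm_real, Real.norm_of_nonneg (sq_nonneg _)]
    rw [← h3, hv, innerL2_sum_smul]
    refine (norm_sum_le _ _).trans (Finset.sum_le_sum fun s _ => ?_)
    refine (norm_sum_le _ _).trans (Finset.sum_le_sum fun r _ => ?_)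
    rw [norm_mul, norm_mul, RCLike.norm_conj, RCLike.norm_conj, RCLike.norm_conj, hc1, hc1,
      one_mul, one_mul]
  have h4 := norm_innerL2_le ψ v
  rw [h1, hψ, one_mul, norm_mul, norm_div, Complex.norm_natCast, Complex.norm_natCast] at h4
  have h5 : (S.card * (‖ψ Q‖ / N)) ^ 2 ≤ normL2 N v ^ 2 := by gcongr
  calc (S.card : ℝ) ^ 2 * ‖ψ Q‖ ^ 2 = N ^ 2 * (S.card * (‖ψ Q‖ / N)) ^ 2 := by
        field_simp
    _ ≤ _ := by gcongr; exact h5.trans h2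

end Quantum

/-! ## A family of elements of norm one -/

section Torus

variable (A : SpecialLinearGroup (Fin 2) ℤ)

lemma iota_mul (m : ℕ) (β γ : OrderMod A m) : iota A m (β * γ) = iota A m β * iota A m γ := by
  have h : ((A.1.det : ℤ) : ZMod m) = 1 := by rw [A.2]; simp
  rw [Matrix.det_fin_two] at h
  push_cast at h
  have ht : ((A.1.trace : ℤ) : ZMod m) = A.1 0 0 + A.1 1 1 := by
    rw [Matrix.trace_fin_two]; push_cast; rfl
  ext i j
  fin_cases i <;> fin_cases j <;>
    simp [iota, Matrix.mul_apply, Fin.sum_univ_two, ht]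
  · linear_combination (β.im * γ.im) * h
  · ring
  · ring
  · linear_combination (β.im * γ.im) * h

/-- The element `δ / δ̄ = δ² / 𝒩(δ)` is in `𝒯^θ(2N)` if `δ` is congruent to an integer
modulo `4`. -/
lemma sq_mem_torusTheta {N : ℕ} (δ : OrderMod A (2 * N)) (v y : ZMod (2 * N))
    (hv : v * QuadraticAlgebra.norm δ = 1) (hy : δ.im = 4 * y) :
    v • δ ^ 2 ∈ torusTheta A N := by
  obtain ⟨l, hl⟩ : ∃ l : ZMod (2 * N), 4 = (level N : ZMod (2 * N)) * l := by
    unfold level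
    split_ifs
    · exact ⟨1, by norm_num⟩
    · exact ⟨2, by norm_num⟩
  have hn := hv
  rw [QuadraticAlgebra.norm_def] at hn
  -- Since `δ - δ̄ = δ.im (α - ᾱ)`, one has `δ/δ̄ - 1 = 4y · v (α - ᾱ) δ` with `α - ᾱ = 2α - tr A`.
  -- The witness is `l v y (2α - tr A) δ` in coordinates.
  refine ⟨?_, ⟨l * (v * y * (-2 * δ.im - A.1.trace * δ.re)),
    l * (v * y * (2 * δ.re + A.1.trace * δ.im))⟩, ?_⟩
  · rw [QuadraticAlgebra.norm_def] at hv ⊢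
    simp only [pow_two, QuadraticAlgebra.re_smul, QuadraticAlgebra.im_smul,
      QuadraticAlgebra.re_mul, QuadraticAlgebra.im_mul, smul_eq_mul]
    linear_combination (v * (δ.re * δ.re + A.1.trace * δ.re * δ.im - -1 * δ.im * δ.im) + 1) * hv
  · ext
    · simp [pow_two, QuadraticAlgebra.re_one]
      simp at hn
      linear_combination hn + v * (-2 * δ.im - A.1.trace * δ.re) * hy +
        v * y * (-2 * δ.im - A.1.trace * δ.re) * hl
    · simp [pow_two, QuadraticAlgebra.im_one]
      linear_combination v * (2 * δ.re + A.1.trace * δ.im) * hy +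
        v * y * (2 * δ.re + A.1.trace * δ.im) * hl

/-- The matrix element `B₁₀` of `ι(δ²/𝒩(δ))`. -/
lemma iota_smul_sq_apply_one_zero (m : ℕ) (δ : OrderMod A m) (v : ZMod m) :
    iota A m (v • δ ^ 2) 1 0 =
      v * (δ.im * (2 * δ.re + A.1.trace * δ.im)) * (A.1 1 0 : ZMod m) := by
  simp [iota, pow_two]
  ring

lemma heckeMatrix_val_eq_mul (N : ℕ) (β γ δ : torusTheta A N) (h : β.1 = γ.1 * δ.1) :
    (heckeMatrix A N β).1 = (heckeMatrix A N γ).1 * (heckeMatrix A N δ).1 := by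
  apply Subtype.ext
  change iota A (2 * N) β.1 = iota A (2 * N) γ.1 * iota A (2 * N) δ.1
  rw [h, iota_mul]

end Torus

end CatMap

namespace CatMap

/-! ### The Hecke translates attached to `1 + 4sα` -/

section Family

variable (A : SpecialLinearGroup (Fin 2) ℤ)

/-- The norm `1 + 4ts + 16s²` of `1 + 4sα`. -/
def shiftNorm (s : ℤ) : ℤ := 1 + 4 * A.1.trace * s + 16 * s ^ 2

/-- The bilinear form with `im ((1 + 4sα)(1 + 4rᾱ))² = 8(s - r) · shiftForm s r`. -/
def shiftForm (s r : ℤ) : ℤ := 1 + 2 * A.1.trace * (s + r) + 16 * s * r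

/-- The element `1 + 4sα`. -/
def shift (m : ℕ) (s : ℤ) : OrderMod A m := ⟨1, 4 * s⟩

lemma norm_shift (m : ℕ) (s : ℤ) : QuadraticAlgebra.norm (shift A m s) = shiftNorm A s := by
  rw [QuadraticAlgebra.norm_def]
  simp only [shift, shiftNorm]
  push_cast
  ring

/-- The norm is odd, so coprimality to `N` already gives coprimality to `2N`. -/
lemma isUnit_shiftNorm {N : ℕ} {s : ℤ} (h : IsCoprime (shiftNorm A s) N) :
    IsUnit (shiftNorm A s : ZMod (2 * N)) := by
  rw [isUnit_intCast_iff]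
  push_cast
  refine IsCoprime.mul_right ?_ h
  exact ⟨1, -(2 * A.1.trace * s + 8 * s ^ 2), by unfold shiftNorm; ring⟩

variable {A} in
/-- For a joint eigenfunction, the Hecke translates of a position state that are attached to
`s, r` have inner product at most `(gcd(N, 8 A₁₀ (s - r) shiftForm s r) / N)^{1/2}`. -/
lemma exists_family {N : ℕ} [NeZero N] {ψ : ZMod N → ℂ} (hψ : IsHeckeEigenfunction A N ψ)
    {ι : Type*} (σ : ι → ℤ) (hσ : ∀ i, IsCoprime (shiftNorm A (σ i)) N) :
    ∃ U : ι → (ZMod N → ℂ) →ₗ[ℂ] (ZMod N → ℂ),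
      (∀ i φ χ, innerL2 N (U i φ) (U i χ) = innerL2 N φ χ) ∧
      (∀ i, ∃ c : ℂ, U i ψ = c • ψ) ∧
      ∀ i j Q, N ^ 3 * ‖innerL2 N (U i (Pi.single Q 1)) (U j (Pi.single Q 1))‖ ^ 2 ≤
        (Int.gcd N (8 * A.1 1 0 * (σ i - σ j) * shiftForm A (σ i) (σ j)) : ℝ) := by
  have hinv : ∀ i, ∃ v : ZMod (2 * N), v * (shiftNorm A (σ i) : ZMod (2 * N)) = 1 :=
    fun i => (isUnit_shiftNorm A (hσ i)).exists_left_inv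
  choose v hv using hinv
  let β : ι → torusTheta A N := fun i => ⟨v i • shift A (2 * N) (σ i) ^ 2,
    sq_mem_torusTheta A _ (v i) (σ i) (by rw [norm_shift, hv]) rfl⟩
  -- With `δ_ij = δ_i δ̄_j`, the quotient `β_i / β_j` is again of the form `δ_ij / δ̄_ij`, so the
  -- same formulas apply to it.
  let δ : ι → ι → OrderMod A (2 * N) := fun i j =>
    shift A (2 * N) (σ i) * star (shift A (2 * N) (σ j))
  have hδim : ∀ i j, (δ i j).im = 4 * ((σ i : ZMod (2 * N)) - σ j) := by
    intro i j
    simp [δ, shift]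
    ring
  have hδre : ∀ i j, (δ i j).re =
      1 + 4 * (A.1.trace : ZMod (2 * N)) * σ j + 16 * σ i * σ j := by
    intro i j
    simp [δ, shift]
    ring
  let η : ι → ι → torusTheta A N := fun i j => ⟨(v i * v j) • δ i j ^ 2,
    sq_mem_torusTheta A _ (v i * v j) ((σ i : ZMod (2 * N)) - σ j) (by
      rw [map_mul, QuadraticAlgebra.norm_star, norm_shift, norm_shift]
      linear_combination (v j * (shiftNorm A (σ j) : ZMod (2 * N))) * hv i + hv j) (hδim i j)⟩
  have hβη : ∀ i j, (β i).1 = (β j).1 * (η i j).1 := by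
    intro i j
    have h1 : algebraMap (ZMod (2 * N)) (OrderMod A (2 * N)) (v j) *
        (shift A (2 * N) (σ j) * star (shift A (2 * N) (σ j))) = 1 := by
      rw [← QuadraticAlgebra.algebraMap_norm_eq_mul_star, norm_shift, ← map_mul, hv, map_one]
    simp only [β, η, δ, Algebra.smul_def, map_mul]
    generalize algebraMap (ZMod (2 * N)) (OrderMod A (2 * N)) (v j) = a at h1 ⊢
    generalize algebraMap (ZMod (2 * N)) (OrderMod A (2 * N)) (v i) = b
    generalize shift A (2 * N) (σ j) = x at h1 ⊢
    generalize star x = y at h1 ⊢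
    linear_combination (-b * shift A (2 * N) (σ i) ^ 2 * (a * (x * y) + 1)) * h1
  refine ⟨fun i => quantization N (heckeMatrix A N (β i)),
    fun i => (quantization_spec N (heckeMatrix A N (β i))).unitary, fun i => hψ.2 (β i), ?_⟩
  intro i j Q
  have hspec := fun b : torusTheta A N => quantization_spec N (heckeMatrix A N b)
  -- Quantization is multiplicative only up to a phase, and absolute values do not see the phase.
  obtain ⟨c, hc, hUc⟩ := (by
    have := (hspec (β j)).comp (hspec (η i j))
    rwa [← heckeMatrix_val_eq_mul A N _ _ _ (hβη i j)] at this :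
    IsQuantization N (heckeMatrix A N (β i)).1 _).unique (hspec (β i))
  have h1 : ‖innerL2 N (quantization N (heckeMatrix A N (β i)) (Pi.single Q 1))
      (quantization N (heckeMatrix A N (β j)) (Pi.single Q 1))‖ =
      ‖quantization N (heckeMatrix A N (η i j)) (Pi.single Q 1) Q‖ / N := by
    have hsm : ∀ φ χ : ZMod N → ℂ, innerL2 N (c • φ) χ = c * innerL2 N φ χ := by
      intro φ χ
      simp only [innerL2, Pi.smul_apply, smul_eq_mul, Finset.mul_sum]
      exact Finset.sum_congr rfl fun x _ => by ring
    rw [hUc, LinearMap.smul_apply, LinearMap.comp_apply, hsm, (hspec (β j)).unitary,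
      innerL2_single, norm_mul, hc, one_mul, norm_div, Complex.norm_natCast]
  -- Multiplying by both norms clears the inverses `v i`, `v j` and leaves an integer.
  have h2 := (hspec (η i j)).normSq_apply_single_le Q
    ((shiftNorm A (σ i) : ZMod (2 * N)) * shiftNorm A (σ j))
    (8 * A.1 1 0 * (σ i - σ j) * shiftForm A (σ i) (σ j)) (by
      change _ * iota A (2 * N) ((v i * v j) • δ i j ^ 2) 1 0 = _
      rw [iota_smul_sq_apply_one_zero, hδim, hδre]
      unfold shiftForm
      push_cast
      linear_combination ((v j * (shiftNorm A (σ j) : ZMod (2 * N))) * hv i + hv j) *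
        (8 * (A.1 1 0 : ZMod (2 * N)) * (σ i - σ j) *
          (1 + 2 * A.1.trace * (σ i + σ j) + 16 * σ i * σ j)))
  rw [h1]
  have hN : (N : ℝ) ≠ 0 := by exact_mod_cast NeZero.ne N
  calc _ = N * ‖quantization N (heckeMatrix A N (η i j)) (Pi.single Q 1) Q‖ ^ 2 := by
        field_simp
    _ ≤ _ := h2

/-- A triangular matrix in `SL₂(ℤ)` has equal diagonal entries `±1`, hence trace `±2`. -/
lemma apply_one_zero_ne_zero (hA : 2 < |A.1.trace|) : A.1 1 0 ≠ 0 := by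
  intro h
  have hdet := A.2
  rw [Matrix.det_fin_two, h, mul_zero, sub_zero] at hdet
  rw [Matrix.trace_fin_two] at hA
  rcases Int.eq_one_or_neg_one_of_mul_eq_one' hdet with ⟨h0, h1⟩ | ⟨h0, h1⟩ <;>
    rw [h0, h1] at hA <;> norm_num at hA

/-- The index set `{s < N : gcd(1 + 4ts + 16s², N) = 1}`. -/
noncomputable def unitShifts (N : ℕ) : Finset ℕ :=
  open Classical in (Finset.range N).filter fun s => IsCoprime (shiftNorm A s) N

lemma unitCount_le_card_unitShifts (N : ℕ) [NeZero N] :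
    unitCount A.1.trace N ≤ (unitShifts A N).card := by
  classical
  unfold unitCount unitShifts
  rw [Nat.card_eq_fintype_card, Fintype.card_subtype]
  refine Finset.card_le_card_of_injOn ZMod.val ?_ (ZMod.val_injective N).injOn
  intro s hs
  simp only [Finset.coe_filter, Finset.mem_univ, true_and, Set.mem_ofPred_eq,
    Finset.mem_range] at hs ⊢
  refine ⟨ZMod.val_lt s, ?_⟩
  rw [← isUnit_intCast_iff]
  unfold shiftNorm
  push_cast
  rwa [ZMod.natCast_zmod_val]

lemma sum_gcd_sub_le {N : ℕ} (hN : N ≠ 0) (r : ℤ) :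
    ∑ s ∈ Finset.range N, Int.gcd N (s - r) ≤ N * N.divisors.card := by
  have := sum_gcd_affine_le hN 1 (-r) one_ne_zero (by simp)
  simpa [sub_eq_add_neg] using this

/-- For fixed `r` the form is affine in `s`. Eliminating `r` from its two coefficients shows that
their gcd divides `2(t² - 4)`, where `t = tr A`; hyperbolicity makes this nonzero, and it does not
depend on `r`. -/
lemma sum_gcd_shiftForm_le (hA : 2 < |A.1.trace|) {N : ℕ} (hN : N ≠ 0) (r : ℤ) :
    ∑ s ∈ Finset.range N, Int.gcd N (shiftForm A s r) ≤
      (2 * (A.1.trace ^ 2 - 4)).natAbs * N * N.divisors.card := by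
  have hK : (2 * (A.1.trace ^ 2 - 4)).natAbs ≠ 0 := by
    have : 4 < A.1.trace ^ 2 := by
      have := sq_lt_sq.mpr (show |(2 : ℤ)| < |A.1.trace| by simpa using hA)
      linarith
    omega
  have hg : Int.gcd (2 * A.1.trace + 16 * r) (1 + 2 * A.1.trace * r) ∣
      (2 * (A.1.trace ^ 2 - 4)).natAbs := by
    rw [← Int.natCast_dvd]
    have h1 := Int.gcd_dvd_left (2 * A.1.trace + 16 * r) (1 + 2 * A.1.trace * r)
    have h2 := Int.gcd_dvd_right (2 * A.1.trace + 16 * r) (1 + 2 * A.1.trace * r)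
    have := dvd_sub (h1.mul_left A.1.trace) (h2.mul_left 8)
    rwa [show A.1.trace * (2 * A.1.trace + 16 * r) - 8 * (1 + 2 * A.1.trace * r) =
      2 * (A.1.trace ^ 2 - 4) by ring] at this
  refine le_of_eq_of_le (Finset.sum_congr rfl fun s _ => ?_)
    (sum_gcd_affine_le hN (2 * A.1.trace + 16 * r) (1 + 2 * A.1.trace * r) hK hg)
  unfold shiftForm
  congr 1
  ring

lemma gcd_mul_mul_le (N : ℕ) {k : ℤ} (hk : k ≠ 0) (x y : ℤ) :
    Int.gcd N (k * x * y) ≤ k.natAbs * (Int.gcd N x * Int.gcd N y) := by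
  rcases Nat.eq_zero_or_pos N with rfl | hN
  · simp [Int.natAbs_mul, mul_assoc]
  simp only [Int.gcd, Int.natAbs_mul, Int.natAbs_natCast]
  have hpos : ∀ z : ℕ, 0 < Nat.gcd N z := fun z => Nat.gcd_pos_of_pos_left _ hN
  calc Nat.gcd N (k.natAbs * x.natAbs * y.natAbs)
      ≤ Nat.gcd N (k.natAbs * x.natAbs) * Nat.gcd N y.natAbs :=
        Nat.le_of_dvd (Nat.mul_pos (hpos _) (hpos _)) (Nat.gcd_mul_right_dvd_mul_gcd _ _ _)
    _ ≤ (Nat.gcd N k.natAbs * Nat.gcd N x.natAbs) * Nat.gcd N y.natAbs :=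
        Nat.mul_le_mul_right _
          (Nat.le_of_dvd (Nat.mul_pos (hpos _) (hpos _)) (Nat.gcd_mul_right_dvd_mul_gcd _ _ _))
    _ ≤ (k.natAbs * Nat.gcd N x.natAbs) * Nat.gcd N y.natAbs := by
        have : Nat.gcd N k.natAbs ≤ k.natAbs :=
          Nat.le_of_dvd (Int.natAbs_pos.mpr hk) (Nat.gcd_dvd_right _ _)
        gcongr
    _ = _ := by ring

/-! ### Assembling the pointwise bound -/

variable {A} in
/-- Hecke eigenfunctions satisfy `|ψ(Q)|² ≪ N^{1/2} τ(N)³`. -/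
theorem exists_normSq_apply_le (hA : 2 < |A.1.trace|) :
    ∃ C : ℝ, 0 < C ∧ ∀ (N : ℕ) [NeZero N] (ψ : ZMod N → ℂ), IsHeckeEigenfunction A N ψ →
      normL2 N ψ = 1 → ∀ Q, ‖ψ Q‖ ^ 2 ≤ C * Real.sqrt N * (N.divisors.card : ℝ) ^ 3 := by
  set D : ℕ := (2 * (A.1.trace ^ 2 - 4)).natAbs with hD
  set k : ℤ := 8 * A.1 1 0 with hk
  have hk0 : k ≠ 0 := mul_ne_zero (by norm_num) (apply_one_zero_ne_zero A hA)
  refine ⟨Real.sqrt k.natAbs * (1 + D), by positivity, fun N _ ψ hψ hψ1 Q => ?_⟩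
  have hN : (0 : ℝ) < N := by exact_mod_cast NeZero.pos N
  set S := unitShifts A N with hS
  set τ := N.divisors.card with hτ
  have hmem : ∀ s ∈ S, s ∈ Finset.range N ∧ IsCoprime (shiftNorm A s) N := by
    intro s hs
    classical
    simpa [hS, unitShifts] using hs
  obtain ⟨U, hU, hev, hbd⟩ := exists_family hψ (fun s : S => ((s : ℕ) : ℤ))
    fun s => (hmem s s.2).2
  have hdual := normSq_apply_le_of_eigenvector Finset.univ U hU hψ1 hev Q
  have hSN : (N : ℝ) ≤ S.card * τ ^ 2 := by
    have := (le_unitCount_mul A.1.trace N).trans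
      (Nat.mul_le_mul_right _ (unitCount_le_card_unitShifts A N))
    exact_mod_cast this
  have hSpos : (0 : ℝ) < S.card := by
    by_contra h
    have h0 : (S.card : ℝ) = 0 := le_antisymm (not_lt.mp h) (Nat.cast_nonneg _)
    rw [h0, zero_mul] at hSN
    linarith
  -- Using `√(xy) ≤ x + y` separates the two gcds, so each can be averaged over `s` alone. The
  -- diagonal `s = r` needs no separate treatment: there the first gcd is `N`.
  have hpair : ∀ s r : S,
      ‖innerL2 N (U s (Pi.single Q 1)) (U r (Pi.single Q 1))‖ ≤
        Real.sqrt k.natAbs / (N * Real.sqrt N) *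
          ((Int.gcd N ((s : ℕ) - (r : ℕ) : ℤ) : ℝ) + Int.gcd N (shiftForm A (s : ℕ) (r : ℕ))) := by
    intro s r
    have h1 := hbd s r Q
    have h2 : (Int.gcd N (8 * A.1 1 0 * ((s : ℕ) - (r : ℕ) : ℤ) *
        shiftForm A (s : ℕ) (r : ℕ)) : ℝ) ≤ k.natAbs *
        ((Int.gcd N ((s : ℕ) - (r : ℕ) : ℤ) : ℝ) * Int.gcd N (shiftForm A (s : ℕ) (r : ℕ))) := by
      exact_mod_cast gcd_mul_mul_le N hk0 _ _
    have h3 := h1.trans h2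
    generalize (Int.gcd N ((s : ℕ) - (r : ℕ) : ℤ)) = x at h3 ⊢
    generalize (Int.gcd N (shiftForm A (s : ℕ) (r : ℕ))) = y at h3 ⊢
    have hsN := Real.sq_sqrt hN.le
    have hsk := Real.sq_sqrt (Nat.cast_nonneg (α := ℝ) k.natAbs)
    have hxy : (0 : ℝ) ≤ (x : ℝ) ^ 2 + x * y + y ^ 2 := by positivity
    rw [div_mul_eq_mul_div, le_div_iff₀ (by positivity)]
    refine (sq_le_sq₀ (by positivity) (by positivity)).mp ?_
    calc _ = N ^ 3 * ‖innerL2 N (U s (Pi.single Q 1)) (U r (Pi.single Q 1))‖ ^ 2 := by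
          rw [mul_pow, mul_pow, hsN]; ring
      _ ≤ _ := h3
      _ ≤ k.natAbs * (x + y : ℝ) ^ 2 := by
          have : (x * y : ℝ) ≤ (x + y : ℝ) ^ 2 := by nlinarith
          gcongr
      _ = _ := by rw [mul_pow, hsk]
  have hsum : ∑ s : S, ∑ r : S, ‖innerL2 N (U s (Pi.single Q 1)) (U r (Pi.single Q 1))‖ ≤
      S.card * (Real.sqrt k.natAbs / (N * Real.sqrt N) * ((1 + D) * N * τ)) := by
    rw [Finset.sum_comm]
    have hr : ∀ r : S, ∑ s : S, ‖innerL2 N (U s (Pi.single Q 1)) (U r (Pi.single Q 1))‖ ≤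
        Real.sqrt k.natAbs / (N * Real.sqrt N) * ((1 + D) * N * τ) := by
      intro r
      refine (Finset.sum_le_sum fun s _ => hpair s r).trans ?_
      rw [← Finset.mul_sum]
      refine mul_le_mul_of_nonneg_left ?_ (by positivity)
      rw [Finset.sum_coe_sort S fun s : ℕ => ((Int.gcd N ((s : ℕ) - (r : ℕ) : ℤ) : ℝ) +
        Int.gcd N (shiftForm A (s : ℕ) (r : ℕ)))]
      -- By positivity the sum may run over all residues, dropping the unit condition.
      refine (Finset.sum_le_sum_of_subset_of_nonneg (fun s hs => (hmem s hs).1)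
        fun _ _ _ => by positivity).trans ?_
      rw [Finset.sum_add_distrib]
      have h1 : (∑ s ∈ Finset.range N, (Int.gcd N ((s : ℕ) - (r : ℕ) : ℤ) : ℝ)) ≤ N * τ := by
        exact_mod_cast sum_gcd_sub_le (NeZero.ne N) (r : ℕ)
      have h2 : (∑ s ∈ Finset.range N, (Int.gcd N (shiftForm A (s : ℕ) (r : ℕ)) : ℝ)) ≤
          D * N * τ := by
        exact_mod_cast sum_gcd_shiftForm_le A hA (NeZero.ne N) (r : ℕ)
      linarith
    refine (Finset.sum_le_sum fun r _ => hr r).trans ?_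
    simp
  have h1 := hdual.trans (mul_le_mul_of_nonneg_left hsum (by positivity))
  rw [Finset.card_univ, Fintype.card_coe] at h1
  have hsN : Real.sqrt N * Real.sqrt N = N := Real.mul_self_sqrt hN.le
  have hs0 : 0 < Real.sqrt N := Real.sqrt_pos.mpr hN
  have h2 : (S.card : ℝ) * ‖ψ Q‖ ^ 2 ≤ Real.sqrt k.natAbs * (1 + D) * Real.sqrt N * τ * N := by
    refine le_of_mul_le_mul_left ?_ hSpos
    calc (S.card : ℝ) * (S.card * ‖ψ Q‖ ^ 2) = S.card ^ 2 * ‖ψ Q‖ ^ 2 := by ring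
      _ ≤ _ := h1
      _ = S.card * (Real.sqrt k.natAbs * (1 + D) * τ * N * (N / Real.sqrt N)) := by
          field_simp
      _ = _ := by rw [Real.div_sqrt]; ring
  refine le_of_mul_le_mul_left ?_ hN
  calc (N : ℝ) * ‖ψ Q‖ ^ 2 ≤ S.card * τ ^ 2 * ‖ψ Q‖ ^ 2 := by gcongr
    _ = τ ^ 2 * (S.card * ‖ψ Q‖ ^ 2) := by ring
    _ ≤ τ ^ 2 * (Real.sqrt k.natAbs * (1 + D) * Real.sqrt N * τ * N) := by gcongr
    _ = _ := by ring

end Family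

end CatMap

/-- `A` is hyperbolic: `|tr A| > 2`. The norm `‖ψ‖` is the supremum norm on `ZMod N → ℂ`. -/
theorem theorem1 (A : Matrix.SpecialLinearGroup (Fin 2) ℤ) (hA : 2 < |A.1.trace|) (ε : ℝ)
    (hε : 0 < ε) :
    ∃ C : ℝ, 0 < C ∧ ∀ (N : ℕ) [NeZero N] (ψ : ZMod N → ℂ),
      CatMap.IsHeckeEigenfunction A N ψ → CatMap.normL2 N ψ = 1 →
        ‖ψ‖ ≤ C * (N : ℝ) ^ (3 / 8 + ε : ℝ) := by
  obtain ⟨C₁, hC₁, h₁⟩ := CatMap.exists_normSq_apply_le hA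
  -- Three divisor factors at `ε / 2` cost `N^{3ε/2}`, within the `N^{2ε}` allowed for the square.
  obtain ⟨C₂, hC₂, h₂⟩ := CatMap.exists_card_divisors_le_rpow (ε := ε / 2) (by linarith)
  refine ⟨Real.sqrt (C₁ * C₂ ^ 3), by positivity, fun N _ ψ hψ hψ1 => ?_⟩
  have hN : (1 : ℝ) ≤ N := by exact_mod_cast NeZero.one_le
  have hN0 : (0 : ℝ) < N := by linarith
  rw [pi_norm_le_iff_of_nonneg (by positivity)]
  intro Q
  refine (sq_le_sq₀ (by positivity) (by positivity)).mp ?_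
  calc ‖ψ Q‖ ^ 2 ≤ C₁ * Real.sqrt N * (N.divisors.card : ℝ) ^ 3 := h₁ N ψ hψ hψ1 Q
    _ ≤ C₁ * Real.sqrt N * (C₂ * (N : ℝ) ^ (ε / 2)) ^ 3 := by
        gcongr
        exact h₂ N (NeZero.ne N)
    _ = C₁ * C₂ ^ 3 * (N : ℝ) ^ (1 / 2 + ε / 2 * 3) := by
        rw [mul_pow, Real.sqrt_eq_rpow, Real.rpow_add hN0, Real.rpow_mul hN0.le]
        norm_cast
        ring
    -- Here `1/2` is weakened to `3/4`.
    _ ≤ C₁ * C₂ ^ 3 * (N : ℝ) ^ ((3 / 8 + ε) * 2) := by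
        gcongr ?_ * ?_
        exact Real.rpow_le_rpow_of_exponent_le hN (by linarith)
    _ = (Real.sqrt (C₁ * C₂ ^ 3) * (N : ℝ) ^ (3 / 8 + ε : ℝ)) ^ 2 := by
        rw [mul_pow, Real.sq_sqrt (by positivity), Real.rpow_mul hN0.le]
        norm_cast
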